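/- **Setting.** Write $\mathbb N=\{1,2,\dots\}$. For $p\ge 0$ and $\varepsilon>0$ put $\kappa_i^2=i^{2p}$ and $\sigma_i^2=\varepsilon^2\kappa_i^2$, $i\in\mathbb N$. For $\theta\in\ell_2$ let $\mathrm P_\theta=\bigotimes_{i\in\mathbb N}N(\theta_i,\sigma_i^2)$ be the law of the data $X=(X_i)_{i\in\mathbb N}$, and let $\mathrm E_\theta$ be the corresponding expectation. Write $\Sigma(I)=\sum_{i\le I}\sigma_i^2$, and $\|\cdot\|$ for the $\ell_2$-norm. $\varphi(\cdot,\mu,v)$ is the density of $N(\mu,v)$, and $N(\mu,0)$ is the Dirac measure at $\mu$. Let $K,\alpha>0$. For $i,I\in\mathbb N$ put $X_i(I)=X_i\mathbf 1\{i\le I\}$, $\tau_i^2(I)=K\sigma_i^2\mathbf 1\{i\le I\}$, $\lambda_I=(e^\alpha-1)e^{-\alpha I}$, $L=\frac{K}{K+1}$. The data-dependent measure is $$\mathrm P(\cdot|X)=\sum_{I\in\mathbb N}\mathrm P_I(\cdot|X)\,\mathrm P(\mathcal I=I|X),\qquad \mathrm P_I(\cdot|X)=\bigotimes_{i\in\mathbb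 N}N\big(X_i(I),L\sigma_i^2\mathbf 1\{i\le I\}\big),$$ $$\mathrm P(\mathcal I=I|X)=\lim_{n\to\infty}\frac{\lambda_I\prod_{i=1}^n\varphi(X_i,X_i(I),\tau_i^2(I)+\sigma_i^2)}{\sum_{J\in\mathbb N}\lambda_J\prod_{i=1}^n\varphi(X_i,X_i(J),\tau_i^2(J)+\sigma_i^2)}.$$ For $\theta_0\in\ell_2$, a surrogate oracle $\bar I_o=\bar I_o(\theta_0)$ is a minimiser over $I\in\mathbb N$ of $$R^2(I,\theta_0)=I\varepsilon^2+\sum_{i>I}\frac{\theta_{0,i}^2}{\kappa_i^2}.$$ **Theorem 3.3 (small ball DDM-probability).** Let $K,\alpha>0$ satisfy $$\alpha<a(K):=\frac14-\frac12\log\Big(\frac{K+1}{2}\Big).$$ Then there is a constant $C_{sb}=C_{sb}(K,\alpha)>0$, depending on $K$ and $\alpha$ only, such that for all $p\ge0$, all $\varepsilon>0$, every $\theta_0\in\ell_2$, every surrogate oracle $\bar I_o$ of $\theta_0$, every measurable data-dependent center $\hat\theta=\hat\theta(X)\in\ell_2$ and every $\delta\in(0,\delta_{sb}]$, where $$\delta_{sb}=1\wedge\left(\sqrt{\frac{K(2p+1)}{K+1}}\Big(\frac{a(K)-\alpha}{4e\,a(K)}\Big)^{p+\frac12}\right),$$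 one has $$\mathrm E_{\theta_0}\mathrm P\big(\|\theta-\hat\theta\|\le\delta\,\Sigma^{1/2}(\bar I_o)\,\big|\,X\big)\le C_{sb}\,\delta\,\big[\log(\delta^{-1})\big]^{p+1/2}.$$ -/

import Mathlib

open MeasureTheory ProbabilityTheory Filter Topology
open scoped ENNReal NNReal

noncomputable section

namespace DDM

/-! Coordinates of sequences and model indices `I` both run over `ℕ+ = {1, 2, …}`. -/

/-- The parameter space `ℓ₂`. -/
abbrev Param : Type := lp (fun _ : ℕ+ => ℝ) 2

/-- The ill-posedness sequence `κ_i² = i^{2p}`. -/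
def kappaSq (p : ℝ) (i : ℕ+) : ℝ := (i : ℝ) ^ (2 * p)

/-- The noise variances `σ_i² = ε² κ_i²`. -/
def noiseVar (ε p : ℝ) (i : ℕ+) : ℝ≥0 := (ε ^ 2 * kappaSq p i).toNNReal

/-- `Σ(I) = ∑_{i ≤ I} σ_i²`. -/
def cumVar (ε p : ℝ) (I : ℕ+) : ℝ := ∑ i ∈ Finset.Icc 1 I, (noiseVar ε p i : ℝ)

/-- The law `P_θ = ⨂_i N(θ_i, σ_i²)` of the data `X = (X_i)`. -/
def dataLaw (ε p : ℝ) (θ : Param) : Measure (ℕ+ → ℝ) :=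
  Measure.infinitePi fun i => gaussianReal (θ i) (noiseVar ε p i)

/-- `X_i(I) = X_i 1{i ≤ I}`. -/
def cutoff (X : ℕ+ → ℝ) (I i : ℕ+) : ℝ := if i ≤ I then X i else 0

/-- The prior variances `τ_i²(I) = K σ_i² 1{i ≤ I}`. -/
def priorVar (K ε p : ℝ) (I i : ℕ+) : ℝ≥0 :=
  if i ≤ I then K.toNNReal * noiseVar ε p i else 0

/-- The prior weights `λ_I = (e^α - 1) e^{-α I}`. -/
def modelPrior (α : ℝ) (I : ℕ+) : ℝ≥0∞ :=
  ENNReal.ofReal ((Real.exp α - 1) * Real.exp (-α * (I : ℝ)))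

/-- `λ_I ∏_{i ≤ n} φ(X_i, X_i(I), τ_i²(I) + σ_i²)`, where `φ(·, μ, v)` is the `N(μ, v)` density. -/
def truncWeight (K α ε p : ℝ) (n : ℕ+) (X : ℕ+ → ℝ) (I : ℕ+) : ℝ≥0∞ :=
  modelPrior α I *
    ∏ i ∈ Finset.Icc 1 n, gaussianPDF (cutoff X I i) (priorVar K ε p I i + noiseVar ε p i) (X i)

/-- The probability `P_n(𝓘 = I | X)` of the model index, based on the first `n` coordinates. -/
def truncIndexProb (K α ε p : ℝ) (n : ℕ+) (X : ℕ+ → ℝ) (I : ℕ+) : ℝ≥0∞ :=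
  truncWeight K α ε p n X I / ∑' J : ℕ+, truncWeight K α ε p n X J

/-- The probability `P(𝓘 = I | X)` of the model index: the limit of `P_n(𝓘 = I | X)`. It exists for
every data sequence, see `tendsto_truncIndexProb`. -/
def indexProb (K α ε p : ℝ) (X : ℕ+ → ℝ) (I : ℕ+) : ℝ≥0∞ :=
  limUnder atTop fun n : ℕ+ => truncIndexProb K α ε p n X I

/-- `P_I(· | X) = ⨂_i N(X_i(I), L σ_i² 1{i ≤ I})` with `L = K / (K + 1)`; a Gaussian with variance
zero is a Dirac measure. -/
def component (K ε p : ℝ) (X : ℕ+ → ℝ) (I : ℕ+) : Measure (ℕ+ → ℝ) :=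
  Measure.infinitePi fun i =>
    gaussianReal (cutoff X I i) (if i ≤ I then (K / (K + 1)).toNNReal * noiseVar ε p i else 0)

/-- The data-dependent measure `P(· | X) = ∑_I P_I(· | X) P(𝓘 = I | X)`. -/
def ddm (K α ε p : ℝ) (X : ℕ+ → ℝ) : Measure (ℕ+ → ℝ) :=
  Measure.sum fun I : ℕ+ => indexProb K α ε p X I • component K ε p X I

/-- The `ℓ₂`-norm `(∑_i x_i²)^{1/2}` of an arbitrary sequence (infinite outside `ℓ₂`). -/
def l2Norm (x : ℕ+ → ℝ) : ℝ≥0∞ := (∑' i, ENNReal.ofReal (x i ^ 2)) ^ (1 / 2 : ℝ)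

/-- `R²(I, θ) = I ε² + ∑_{i > I} θ_i² / κ_i²`. -/
def surrogateRisk (ε p : ℝ) (θ : Param) (I : ℕ+) : ℝ :=
  (I : ℝ) * ε ^ 2 + ∑' i : ℕ+, if I < i then θ i ^ 2 / kappaSq p i else 0

/-- `I` is a surrogate oracle for `θ`: it minimises `R²(·, θ)` over `{1, 2, …}`. -/
def IsSurrogateOracle (ε p : ℝ) (θ : Param) (I : ℕ+) : Prop :=
  ∀ J : ℕ+, surrogateRisk ε p θ I ≤ surrogateRisk ε p θ J

/-- `a(K) = 1/4 - (1/2) log((K + 1) / 2)`. -/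
def aConst (K : ℝ) : ℝ := 1 / 4 - 1 / 2 * Real.log ((K + 1) / 2)

/-- `δ_sb = 1 ∧ (√(K(2p+1)/(K+1)) ((a(K) - α) / (4 e a(K)))^{p + 1/2})`. -/
def deltaSb (K α p : ℝ) : ℝ :=
  min 1 (√(K * (2 * p + 1) / (K + 1)) *
    ((aConst K - α) / (4 * Real.exp 1 * aConst K)) ^ (p + 1 / 2))

/-! ### The limit defining `indexProb` exists -/

theorem noiseVar_pos {ε : ℝ} (hε : 0 < ε) (p : ℝ) (i : ℕ+) : 0 < noiseVar ε p i := by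
  have : (0 : ℝ) < (i : ℝ) := by exact_mod_cast i.pos
  unfold noiseVar kappaSq
  rw [Real.toNNReal_pos]
  positivity

/-- `φ(X_i, X_i, (K + 1) σ_i²) / φ(X_i, 0, σ_i²)`. -/
def densRatio (K ε p : ℝ) (X : ℕ+ → ℝ) (i : ℕ+) : ℝ≥0∞ :=
  gaussianPDF (X i) (K.toNNReal * noiseVar ε p i + noiseVar ε p i) (X i) /
    gaussianPDF 0 (noiseVar ε p i) (X i)

/-- The unnormalised index weight `λ_I ∏_{i ≤ I} φ(X_i, X_i, (K + 1) σ_i²) / φ(X_i, 0, σ_i²)`. -/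
def indexWeight (K α ε p : ℝ) (X : ℕ+ → ℝ) (I : ℕ+) : ℝ≥0∞ :=
  modelPrior α I * ∏ i ∈ Finset.Icc 1 I, densRatio K ε p X i

theorem densRatio_ne_top {ε : ℝ} (hε : 0 < ε) (K p : ℝ) (X : ℕ+ → ℝ) (i : ℕ+) :
    densRatio K ε p X i ≠ ∞ := by
  have h := noiseVar_pos hε p i
  exact ENNReal.div_ne_top ENNReal.ofReal_ne_top (gaussianPDF_pos _ h.ne' _).ne'

theorem indexWeight_ne_top {ε : ℝ} (hε : 0 < ε) (K α p : ℝ) (X : ℕ+ → ℝ) (I : ℕ+) :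
    indexWeight K α ε p X I ≠ ∞ :=
  ENNReal.mul_ne_top ENNReal.ofReal_ne_top
    (ENNReal.prod_ne_top fun i _ => densRatio_ne_top hε K p X i)

theorem truncWeight_eq {ε : ℝ} (hε : 0 < ε) (K α p : ℝ) (n : ℕ+) (X : ℕ+ → ℝ) (I : ℕ+) :
    truncWeight K α ε p n X I =
      (∏ i ∈ Finset.Icc 1 n, gaussianPDF 0 (noiseVar ε p i) (X i)) *
        (modelPrior α I * ∏ i ∈ Finset.Icc 1 (min n I), densRatio K ε p X i) := by
  have key : ∀ i, gaussianPDF (cutoff X I i) (priorVar K ε p I i + noiseVar ε p i) (X i) =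
      gaussianPDF 0 (noiseVar ε p i) (X i) * (if i ≤ I then densRatio K ε p X i else 1) := by
    intro i
    have h := noiseVar_pos hε p i
    unfold cutoff priorVar densRatio
    split_ifs with hi
    · rw [ENNReal.mul_div_cancel (gaussianPDF_pos _ h.ne' _).ne' ENNReal.ofReal_ne_top]
    · simp
  have hfilter : (Finset.Icc 1 n).filter (fun i => i ≤ I) = Finset.Icc 1 (min n I) := by
    ext i; simp
  unfold truncWeight
  rw [Finset.prod_congr rfl fun i _ => key i, Finset.prod_mul_distrib, ← Finset.prod_filter,
    hfilter]
  ring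

theorem truncIndexProb_eq {ε : ℝ} (hε : 0 < ε) (K α p : ℝ) (n : ℕ+) (X : ℕ+ → ℝ) (I : ℕ+) :
    truncIndexProb K α ε p n X I =
      (modelPrior α I * ∏ i ∈ Finset.Icc 1 (min n I), densRatio K ε p X i) /
        ∑' J : ℕ+, modelPrior α J * ∏ i ∈ Finset.Icc 1 (min n J), densRatio K ε p X i := by
  unfold truncIndexProb
  simp_rw [truncWeight_eq hε K α p n X]
  rw [ENNReal.tsum_mul_left]
  refine ENNReal.mul_div_mul_left _ _ ?_ ?_
  · exact Finset.prod_ne_zero_iff.2 fun i _ => (gaussianPDF_pos _ (noiseVar_pos hε p i).ne' _).ne'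
  · exact ENNReal.prod_ne_top fun i _ => ENNReal.ofReal_ne_top

theorem modelPrior_add (α : ℝ) (n k : ℕ+) :
    modelPrior α (n + k) = modelPrior α n * ENNReal.ofReal (Real.exp (-α * (k : ℝ))) := by
  unfold modelPrior
  rw [← ENNReal.ofReal_mul' (Real.exp_pos _).le, mul_assoc, ← Real.exp_add]
  congr 3
  push_cast
  ring

theorem tsum_exp_ne_top {α : ℝ} (hα : 0 < α) :
    ∑' k : ℕ+, ENNReal.ofReal (Real.exp (-α * (k : ℝ))) ≠ ∞ := by
  have hs : Summable fun k : ℕ => Real.exp (-α * (k : ℝ)) := by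
    have := Real.summable_exp_nat_mul_iff.2 (neg_neg_of_pos hα)
    refine this.congr fun k => ?_
    rw [mul_comm]
  have hs' : Summable fun k : ℕ+ => Real.exp (-α * (k : ℝ)) :=
    hs.comp_injective PNat.coe_injective
  exact hs'.tsum_ofReal_ne_top

theorem tendsto_denominator {α : ℝ} (hα : 0 < α) (K ε p : ℝ) (X : ℕ+ → ℝ) :
    Tendsto (fun n : ℕ+ =>
        ∑' J : ℕ+, modelPrior α J * ∏ i ∈ Finset.Icc 1 (min n J), densRatio K ε p X i) atTop
      (𝓝 (∑' J : ℕ+, indexWeight K α ε p X J)) := by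
  set G : ℕ+ → ℝ≥0∞ := fun I => ∏ i ∈ Finset.Icc 1 I, densRatio K ε p X i with hG
  have hpart : Tendsto (fun n : ℕ+ => ∑ J ∈ Finset.Icc 1 n, indexWeight K α ε p X J) atTop
      (𝓝 (∑' J : ℕ+, indexWeight K α ε p X J)) := by
    refine ENNReal.summable.hasSum.comp (tendsto_atTop_finset_of_monotone ?_ ?_)
    · intro a b hab i; simp only [Finset.mem_Icc]; exact fun h => ⟨h.1, h.2.trans hab⟩
    · intro i; exact ⟨i, by simp⟩
  have hlow : ∀ n : ℕ+, ∑ J ∈ Finset.Icc 1 n, indexWeight K α ε p X J ≤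
      ∑' J : ℕ+, modelPrior α J * G (min n J) := by
    intro n
    refine le_trans (le_of_eq (Finset.sum_congr rfl fun J hJ => ?_)) (ENNReal.sum_le_tsum _)
    rw [min_eq_right (Finset.mem_Icc.1 hJ).2]
    rfl
  set c := ∑' k : ℕ+, ENNReal.ofReal (Real.exp (-α * (k : ℝ))) with hc
  have hupp : ∀ n : ℕ+, ∑' J : ℕ+, modelPrior α J * G (min n J) ≤
      (∑' J : ℕ+, indexWeight K α ε p X J) + indexWeight K α ε p X n * c := by
    intro n
    have h1 : ∀ J : ℕ+, modelPrior α J * G (min n J) ≤ indexWeight K α ε p X J +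
        (if n < J then modelPrior α J * G n else 0) := by
      intro J
      split_ifs with h
      · rw [min_eq_left h.le]; exact le_add_self
      · rw [min_eq_right (not_lt.1 h), add_zero]; rfl
    refine (ENNReal.tsum_le_tsum h1).trans ?_
    rw [ENNReal.tsum_add]
    refine add_le_add le_rfl ?_
    have hinj : Function.Injective fun k : ℕ+ => n + k := add_right_injective n
    have hsupp : Function.support (fun J : ℕ+ => if n < J then modelPrior α J * G n else 0) ⊆
        Set.range fun k : ℕ+ => n + k := by
      intro J hJ
      have : n < J := by
        by_contra h
        simp [h] at hJ
      exact ⟨J - n, PNat.add_sub_of_lt this⟩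
    rw [← hinj.tsum_eq hsupp, hc, ← ENNReal.tsum_mul_left]
    refine ENNReal.tsum_le_tsum fun k => ?_
    simp only [PNat.lt_add_right, if_true, modelPrior_add, indexWeight]
    rw [mul_right_comm]
  by_cases htop : ∑' J : ℕ+, indexWeight K α ε p X J = ∞
  · rw [htop] at hpart ⊢
    exact tendsto_of_tendsto_of_tendsto_of_le_of_le hpart tendsto_const_nhds hlow fun _ => le_top
  · refine tendsto_of_tendsto_of_tendsto_of_le_of_le hpart ?_ hlow hupp
    have h0 : Tendsto (indexWeight K α ε p X) atTop (𝓝 0) := by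
      have := ENNReal.tendsto_cofinite_zero_of_tsum_ne_top htop
      exact this.mono_left atTop_le_cofinite
    have h1 : Tendsto (fun n => indexWeight K α ε p X n * c) atTop (𝓝 (0 * c)) :=
      ENNReal.Tendsto.mul_const h0 (Or.inr (tsum_exp_ne_top hα))
    have h2 := (tendsto_const_nhds (x := ∑' J : ℕ+, indexWeight K α ε p X J)).add h1
    simpa using h2

/-- For every data sequence the probabilities `P_n(𝓘 = I | X)` converge. -/
theorem tendsto_truncIndexProb {α ε : ℝ} (hα : 0 < α) (hε : 0 < ε) (K p : ℝ) (X : ℕ+ → ℝ)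
    (I : ℕ+) :
    Tendsto (fun n : ℕ+ => truncIndexProb K α ε p n X I) atTop
      (𝓝 (indexWeight K α ε p X I / ∑' J : ℕ+, indexWeight K α ε p X J)) := by
  have h := ENNReal.Tendsto.const_div (a := indexWeight K α ε p X I)
    (tendsto_denominator hα K ε p X) (Or.inr (indexWeight_ne_top hε K α p X I))
  refine h.congr' ?_
  filter_upwards [eventually_ge_atTop I] with n hn
  rw [truncIndexProb_eq hε, min_eq_right hn]
  rfl

theorem indexProb_eq {α ε : ℝ} (hα : 0 < α) (hε : 0 < ε) (K p : ℝ) (X : ℕ+ → ℝ) (I : ℕ+) :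
    indexProb K α ε p X I =
      indexWeight K α ε p X I / ∑' J : ℕ+, indexWeight K α ε p X J :=
  (tendsto_truncIndexProb hα hε K p X I).limUnder_eq

/-! ### Surrogate oracles exist -/

theorem exists_isSurrogateOracle {ε : ℝ} (hε : 0 < ε) (p : ℝ) (θ : Param) :
    ∃ I : ℕ+, IsSurrogateOracle ε p θ I := by
  have hnn : ∀ I : ℕ+, (I : ℝ) * ε ^ 2 ≤ surrogateRisk ε p θ I := by
    intro I
    unfold surrogateRisk
    refine le_add_of_nonneg_right (tsum_nonneg fun i => ?_)
    split_ifs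
    · have : (0 : ℝ) ≤ (i : ℝ) := by positivity
      unfold kappaSq
      positivity
    · exact le_rfl
  obtain ⟨N, hN⟩ := exists_nat_gt (surrogateRisk ε p θ 1 / ε ^ 2)
  have hε2 : 0 < ε ^ 2 := by positivity
  rw [div_lt_iff₀ hε2] at hN
  set M : ℕ+ := N.succPNat with hM
  obtain ⟨I, -, hI⟩ := Finset.exists_min_image (Finset.Icc 1 M) (surrogateRisk ε p θ)
    ⟨1, by simp⟩
  refine ⟨I, fun J => ?_⟩
  by_cases hJ : J ≤ M
  · exact hI J (by simp [hJ])
  · have h1 : surrogateRisk ε p θ I ≤ surrogateRisk ε p θ 1 := hI 1 (by simp)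
    have h2 : (N : ℝ) ≤ (J : ℝ) := by
      have : (M : ℕ) < (J : ℕ) := PNat.coe_lt_coe _ _ |>.2 (not_le.1 hJ)
      have h3 : N ≤ (J : ℕ) := by
        rw [hM, Nat.succPNat_coe] at this
        omega
      exact_mod_cast h3
    have h4 : (N : ℝ) * ε ^ 2 ≤ (J : ℝ) * ε ^ 2 := by gcongr
    linarith [hnn J]

end DDM

end

namespace DDM

/-! ### Gaussian integrals under product measures -/

/-! Write n for the surrogate oracle, P = p + 1/2, l = log(1/δ), L = K/(K+1), b = a(K) - α. Two
estimates carry the proof.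

Small indices are unlikely. For I ≤ n the posterior odds of I against n are a product over I < i ≤ n
of e^α √(K+1) exp(-X_i²/(2σ_i²)). Each exponential has expectation 2^{-1/2} exp(-θ_i²/(4σ_i²)), and
minimality of n gives ∑_{I<i≤n} θ_i²/σ_i² ≥ n - I. Hence E P(𝓘 = I | X) ≤ exp(-b(n - I))
(`lintegral_indexProb_le`); this is where a(K) comes from.

Components spread. An exponential Markov bound on finitely many active coordinates controls the ball
under P_I, uniformly in X and in the center (`component_ball_le`). The first coordinate alone gives
√(e/L) δ n^P; a block (k, 2k] with k of order n gives a k-th power, at most δ once l is large.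

If n ≤ l, the one-coordinate bound is already of order δ l^P. If n > l, indices above about n/2
contribute at most δ, and for the others the factor n^P is beaten by their expected mass n
exp(-bn/2). When l is bounded or δ l^P ≥ 1, the bound 1 suffices. -/

theorem lintegral_finset_prod_infinitePi {ι : Type*} (μ : ι → Measure ℝ)
    [∀ i, IsProbabilityMeasure (μ i)] (S : Finset ι) (f : ι → ℝ → ℝ≥0∞)
    (hf : ∀ i, Measurable (f i)) :
    ∫⁻ x, ∏ i ∈ S, f i (x i) ∂(Measure.infinitePi μ) = ∏ i ∈ S, ∫⁻ y, f i y ∂(μ i) := by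
  have hind : iIndepFun (fun i (x : ι → ℝ) => f i (x i)) (Measure.infinitePi μ) :=
    iIndepFun_infinitePi (X := f) hf
  rw [lintegral_prod_eq_prod_lintegral_of_indepFun S _ hind
    fun i => (hf i).comp (measurable_pi_apply i)]
  refine Finset.prod_congr rfl fun i _ => ?_
  rw [← Measure.infinitePi_map_eval μ i, lintegral_map (hf i) (measurable_pi_apply i)]

theorem lintegral_gaussianReal (μ : ℝ) {v : ℝ≥0} (hv : v ≠ 0) {f : ℝ → ℝ≥0∞}
    (hf : Measurable f) :
    ∫⁻ x, f x ∂(gaussianReal μ v) = ∫⁻ x, gaussianPDF μ v x * f x := by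
  rw [gaussianReal_of_var_ne_zero _ hv,
    lintegral_withDensity_eq_lintegral_mul _ (measurable_gaussianPDF μ v) hf]
  rfl

/-- Completing the square turns the integrand into a constant times the N(μ/2, v/2) density. -/
theorem lintegral_exp_neg_sq_div_gaussianReal (μ : ℝ) {v : ℝ≥0} (hv : v ≠ 0) :
    ∫⁻ x, ENNReal.ofReal (Real.exp (-(x ^ 2 / (2 * v)))) ∂(gaussianReal μ v) =
      ENNReal.ofReal (Real.exp (-(1 / 2 * Real.log 2) - μ ^ 2 / v / 4)) := by
  have hv0 : (0 : ℝ) < v := by exact_mod_cast pos_iff_ne_zero.2 hv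
  rw [lintegral_gaussianReal μ hv (by fun_prop)]
  have key : ∀ x, gaussianPDF μ v x * ENNReal.ofReal (Real.exp (-(x ^ 2 / (2 * v)))) =
      ENNReal.ofReal (Real.exp (-(1 / 2 * Real.log 2) - μ ^ 2 / v / 4)) *
        gaussianPDF (μ / 2) (v / 2) x := by
    intro x
    unfold gaussianPDF gaussianPDFReal
    rw [← ENNReal.ofReal_mul (by positivity), ← ENNReal.ofReal_mul (by positivity)]
    congr 1
    have hs : (√(2 * Real.pi * v))⁻¹ =
        Real.exp (-(1 / 2 * Real.log 2)) * (√(2 * Real.pi * ((v / 2 : ℝ≥0) : ℝ)))⁻¹ := by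
      have h2 : Real.exp (-(1 / 2 * Real.log 2)) = (√2)⁻¹ := by
        rw [Real.exp_neg, Real.sqrt_eq_rpow, Real.rpow_def_of_pos two_pos]
        ring_nf
      rw [h2, ← mul_inv, ← Real.sqrt_mul zero_le_two]
      congr 2
      push_cast
      ring
    have he : Real.exp (-(x - μ) ^ 2 / (2 * v)) * Real.exp (-(x ^ 2 / (2 * v))) =
        Real.exp (-(μ ^ 2 / v / 4)) *
          Real.exp (-(x - μ / 2) ^ 2 / (2 * ((v / 2 : ℝ≥0) : ℝ))) := by
      rw [← Real.exp_add, ← Real.exp_add]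
      congr 1
      push_cast
      field_simp
      ring
    rw [hs, sub_eq_add_neg (-(1 / 2 * Real.log 2)), Real.exp_add, mul_assoc, he]
    ring
  simp_rw [key]
  rw [lintegral_const_mul _ (measurable_gaussianPDF _ _),
    lintegral_gaussianPDF_eq_one _ (by simpa using hv), mul_one]

/-- Bounding the exponential in the N(μ, v) density by 1 leaves a multiple of the N(c, 1/(2t))
density, so the bound depends on neither μ nor c. -/
theorem lintegral_exp_neg_mul_sq_gaussianReal_le (μ c : ℝ) {v : ℝ≥0} (hv : v ≠ 0) {t : ℝ}
    (ht : 0 < t) :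
    ∫⁻ x, ENNReal.ofReal (Real.exp (-(t * (x - c) ^ 2))) ∂(gaussianReal μ v) ≤
      ENNReal.ofReal (√(1 / (2 * t * v))) := by
  have hv0 : (0 : ℝ) < v := by exact_mod_cast pos_iff_ne_zero.2 hv
  rw [lintegral_gaussianReal μ hv (by fun_prop)]
  set w : ℝ≥0 := (1 / (2 * t)).toNNReal with hw
  have hwc : (w : ℝ) = 1 / (2 * t) := Real.coe_toNNReal _ (by positivity)
  have hw0 : w ≠ 0 := by
    intro h
    rw [h] at hwc
    have : 0 < 1 / (2 * t) := by positivity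
    simp at hwc
    linarith
  have key : ∀ x, gaussianPDF μ v x * ENNReal.ofReal (Real.exp (-(t * (x - c) ^ 2))) ≤
      ENNReal.ofReal (√(1 / (2 * t * v))) * gaussianPDF c w x := by
    intro x
    unfold gaussianPDF gaussianPDFReal
    rw [← ENNReal.ofReal_mul (by positivity), ← ENNReal.ofReal_mul (by positivity)]
    refine ENNReal.ofReal_le_ofReal ?_
    have hs : (√(2 * Real.pi * v))⁻¹ = √(1 / (2 * t * v)) * (√(2 * Real.pi * w))⁻¹ := by
      rw [← Real.sqrt_inv, ← Real.sqrt_inv, ← Real.sqrt_mul (by positivity), hwc]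
      congr 1
      field_simp
    have he : -(x - c) ^ 2 / (2 * (w : ℝ)) = -(t * (x - c) ^ 2) := by
      rw [hwc]
      field_simp
    rw [he, hs, ← mul_assoc]
    refine mul_le_mul_of_nonneg_right ?_ (Real.exp_pos _).le
    refine mul_le_of_le_one_right (by positivity) (Real.exp_le_one_iff.2 ?_)
    rw [neg_div]
    exact neg_nonpos.2 (by positivity)
  refine (lintegral_mono key).trans ?_
  rw [lintegral_const_mul _ (measurable_gaussianPDF _ _), lintegral_gaussianPDF_eq_one _ hw0,
    mul_one]

/-! ### The index probabilities -/

theorem densRatio_eq {K ε : ℝ} (hK : 0 < K) (hε : 0 < ε) (p : ℝ) (X : ℕ+ → ℝ) (i : ℕ+) :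
    densRatio K ε p X i = ENNReal.ofReal
      (Real.exp (X i ^ 2 / (2 * noiseVar ε p i) - 1 / 2 * Real.log (K + 1))) := by
  have h := noiseVar_pos hε p i
  have h0 : (0 : ℝ) < noiseVar ε p i := by exact_mod_cast h
  have hp : 0 < gaussianPDFReal 0 (noiseVar ε p i) (X i) := gaussianPDFReal_pos _ _ _ h.ne'
  unfold densRatio gaussianPDF
  rw [← ENNReal.ofReal_div_of_pos hp]
  congr 1
  rw [div_eq_iff hp.ne']
  unfold gaussianPDFReal
  have hs : √(2 * Real.pi * ((K.toNNReal * noiseVar ε p i + noiseVar ε p i : ℝ≥0) : ℝ)) =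
      Real.exp (1 / 2 * Real.log (K + 1)) * √(2 * Real.pi * noiseVar ε p i) := by
    have h2 : Real.exp (1 / 2 * Real.log (K + 1)) = √(K + 1) := by
      rw [Real.sqrt_eq_rpow, Real.rpow_def_of_pos (by positivity), mul_comm]
    rw [h2, ← Real.sqrt_mul (by positivity)]
    push_cast
    rw [Real.coe_toNNReal _ hK.le]
    congr 1
    ring
  rw [hs, mul_inv, ← Real.exp_neg]
  simp only [sub_self, sub_zero]
  have he : Real.exp (X i ^ 2 / (2 * noiseVar ε p i) - 1 / 2 * Real.log (K + 1)) =
      Real.exp (-(1 / 2 * Real.log (K + 1))) * Real.exp (X i ^ 2 / (2 * noiseVar ε p i)) := by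
    rw [← Real.exp_add]; ring_nf
  have he2 : Real.exp (X i ^ 2 / (2 * noiseVar ε p i)) *
      Real.exp (-X i ^ 2 / (2 * noiseVar ε p i)) = 1 := by
    rw [← Real.exp_add, neg_div, add_neg_cancel, Real.exp_zero]
  rw [he]
  calc _ = Real.exp (-(1 / 2 * Real.log (K + 1))) * (√(2 * Real.pi * noiseVar ε p i))⁻¹ * 1 := by
        simp
    _ = _ := by rw [← he2]; ring

theorem measurable_indexProb {K α ε : ℝ} (hK : 0 < K) (hα : 0 < α) (hε : 0 < ε) (p : ℝ)
    (I : ℕ+) : Measurable fun X => indexProb K α ε p X I := by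
  have hW : ∀ J, Measurable fun X => indexWeight K α ε p X J := by
    intro J
    unfold indexWeight
    simp_rw [densRatio_eq hK hε]
    fun_prop
  simp_rw [indexProb_eq hα hε]
  exact (hW I).div (Measurable.tsum hW)

/-- An inequality only: the normalising sum may be infinite for some X, and then all the quotients
vanish. -/
theorem tsum_indexProb_le_one {α ε : ℝ} (hα : 0 < α) (hε : 0 < ε) (K p : ℝ) (X : ℕ+ → ℝ) :
    ∑' I, indexProb K α ε p X I ≤ 1 := by
  simp_rw [indexProb_eq hα hε, div_eq_mul_inv]
  rw [ENNReal.tsum_mul_right]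
  exact ENNReal.div_self_le_one

theorem prod_Icc_one_mul_prod_Ioc {M : Type*} [CommMonoid M] (f : ℕ+ → M) {I n : ℕ+}
    (h : I ≤ n) :
    (∏ i ∈ Finset.Icc 1 I, f i) * ∏ i ∈ Finset.Ioc I n, f i = ∏ i ∈ Finset.Icc 1 n, f i := by
  rw [← Finset.prod_union]
  · congr 1
    ext i
    simp only [Finset.mem_union, Finset.mem_Icc, Finset.mem_Ioc, one_le, true_and]
    constructor
    · rintro (h1 | h1)
      · exact h1.trans h
      · exact h1.2
    · intro h1
      exact (le_or_gt i I).imp id fun h2 => ⟨h2, h1⟩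
  · rw [Finset.disjoint_left]
    intro i hi hi'
    exact absurd (Finset.mem_Icc.1 hi).2 (not_le.2 (Finset.mem_Ioc.1 hi').1)

theorem cast_card_Ioc {I n : ℕ+} (h : I ≤ n) :
    ((Finset.Ioc I n).card : ℝ) = (n : ℝ) - (I : ℝ) := by
  rw [PNat.card_Ioc, Nat.cast_sub (by exact_mod_cast h)]

/-- Going down from n to I, each dropped coordinate gains e^α from the prior and loses its density
ratio. -/
theorem indexWeight_eq_mul_prod {K ε : ℝ} (hK : 0 < K) (hε : 0 < ε) (α p : ℝ) (X : ℕ+ → ℝ)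
    {I n : ℕ+} (h : I ≤ n) :
    indexWeight K α ε p X I = indexWeight K α ε p X n * ∏ i ∈ Finset.Ioc I n,
      (ENNReal.ofReal (Real.exp (α + 1 / 2 * Real.log (K + 1))) *
        ENNReal.ofReal (Real.exp (-(X i ^ 2 / (2 * noiseVar ε p i))))) := by
  have hprior : modelPrior α I =
      modelPrior α n * ∏ _i ∈ Finset.Ioc I n, ENNReal.ofReal (Real.exp α) := by
    rw [Finset.prod_const, ← ENNReal.ofReal_pow (Real.exp_pos _).le, ← Real.exp_nat_mul,
      cast_card_Ioc h]
    unfold modelPrior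
    rw [← ENNReal.ofReal_mul' (Real.exp_pos _).le, mul_assoc, ← Real.exp_add]
    congr 3
    ring
  unfold indexWeight
  rw [← prod_Icc_one_mul_prod_Ioc _ h, hprior, mul_assoc, mul_assoc, mul_assoc,
    ← Finset.prod_mul_distrib, mul_comm (∏ i ∈ Finset.Ioc I n, _)]
  congr 2
  refine Finset.prod_congr rfl fun i _ => ?_
  rw [densRatio_eq hK hε, ← ENNReal.ofReal_mul (Real.exp_pos _).le,
    ← ENNReal.ofReal_mul (Real.exp_pos _).le, ← Real.exp_add, ← Real.exp_add]
  congr 2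
  ring

theorem indexProb_le_prod {K α ε : ℝ} (hK : 0 < K) (hα : 0 < α) (hε : 0 < ε) (p : ℝ)
    (X : ℕ+ → ℝ) {I n : ℕ+} (h : I ≤ n) :
    indexProb K α ε p X I ≤ ∏ i ∈ Finset.Ioc I n,
      (ENNReal.ofReal (Real.exp (α + 1 / 2 * Real.log (K + 1))) *
        ENNReal.ofReal (Real.exp (-(X i ^ 2 / (2 * noiseVar ε p i))))) := by
  rw [indexProb_eq hα hε, indexWeight_eq_mul_prod hK hε α p X h, ENNReal.mul_div_right_comm,
    ← indexProb_eq hα hε]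
  exact mul_le_of_le_one_left' ((ENNReal.le_tsum n).trans (tsum_indexProb_le_one hα hε K p X))

/-! ### Surrogate oracles -/

theorem one_le_kappaSq {p : ℝ} (hp : 0 ≤ p) (i : ℕ+) : 1 ≤ kappaSq p i :=
  Real.one_le_rpow (by exact_mod_cast i.pos) (by positivity)

theorem coe_noiseVar (ε p : ℝ) (i : ℕ+) : (noiseVar ε p i : ℝ) = ε ^ 2 * kappaSq p i := by
  refine Real.coe_toNNReal _ (mul_nonneg (sq_nonneg _) ?_)
  exact Real.rpow_nonneg (by positivity) _

theorem summable_sq_div_kappaSq {p : ℝ} (hp : 0 ≤ p) (θ : Param) :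
    Summable fun i => θ i ^ 2 / kappaSq p i := by
  have h := (lp.memℓp θ).summable (by norm_num)
  simp only [ENNReal.toReal_ofNat, Real.rpow_ofNat, Real.norm_eq_abs, sq_abs] at h
  exact h.of_nonneg_of_le
    (fun i => div_nonneg (sq_nonneg _) (zero_le_one.trans (one_le_kappaSq hp i)))
    fun i => div_le_self (sq_nonneg _) (one_le_kappaSq hp i)

/-- In R²(n) ≤ R²(I) the tails beyond n cancel; dividing by ε² turns κ_i² into σ_i². -/
theorem IsSurrogateOracle.le_sum_Ioc {ε p : ℝ} {θ : Param} {n : ℕ+} (hε : 0 < ε) (hp : 0 ≤ p)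
    (hn : IsSurrogateOracle ε p θ n) {I : ℕ+} (h : I ≤ n) :
    (n : ℝ) - I ≤ ∑ i ∈ Finset.Ioc I n, θ i ^ 2 / noiseVar ε p i := by
  have hs := summable_sq_div_kappaSq hp θ
  have hs' : ∀ J : ℕ+, Summable fun i => if J < i then θ i ^ 2 / kappaSq p i else 0 := by
    intro J
    refine (hs.indicator {i | J < i}).congr fun i => ?_
    simp only [Set.indicator_apply, Set.mem_ofPred_eq]
  have h1 := hn I
  unfold surrogateRisk at h1
  have h2 : (∑' i : ℕ+, if I < i then θ i ^ 2 / kappaSq p i else 0) =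
      (∑' i : ℕ+, if n < i then θ i ^ 2 / kappaSq p i else 0) +
        ∑ i ∈ Finset.Ioc I n, θ i ^ 2 / kappaSq p i := by
    rw [← Finset.tsum_subtype' (Finset.Ioc I n) fun i => θ i ^ 2 / kappaSq p i,
      tsum_subtype (Finset.Ioc I n : Set ℕ+) fun i => θ i ^ 2 / kappaSq p i,
      ← (hs' n).tsum_add (hs.indicator _)]
    congr 1
    ext i
    simp only [Set.indicator_apply, Finset.coe_Ioc, Set.mem_Ioc]
    by_cases h3 : n < i
    · simp [h3, h.trans_lt h3]
    · simp [h3, not_lt.1 h3]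
  have h4 : ((n : ℝ) - I) * ε ^ 2 ≤ ∑ i ∈ Finset.Ioc I n, θ i ^ 2 / kappaSq p i := by
    rw [h2] at h1
    linarith
  have h5 : ∑ i ∈ Finset.Ioc I n, θ i ^ 2 / noiseVar ε p i =
      (∑ i ∈ Finset.Ioc I n, θ i ^ 2 / kappaSq p i) / ε ^ 2 := by
    rw [Finset.sum_div]
    refine Finset.sum_congr rfl fun i _ => ?_
    rw [coe_noiseVar, mul_comm, div_div]
  rw [h5, le_div_iff₀ (by positivity)]
  exact h4

theorem lintegral_indexProb_le {K α ε p : ℝ} (hK : 0 < K) (hα : 0 < α) (hε : 0 < ε)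
    (hp : 0 ≤ p) {θ : Param} {I n : ℕ+} (hn : IsSurrogateOracle ε p θ n) (h : I ≤ n) :
    ∫⁻ X, indexProb K α ε p X I ∂(dataLaw ε p θ) ≤
      ENNReal.ofReal (Real.exp (-((aConst K - α) * ((n : ℝ) - I)))) := by
  refine (lintegral_mono fun X => indexProb_le_prod hK hα hε p X h).trans ?_
  unfold dataLaw
  rw [lintegral_finset_prod_infinitePi (fun i => gaussianReal (θ i) (noiseVar ε p i))
    (Finset.Ioc I n) (fun i x => ENNReal.ofReal (Real.exp (α + 1 / 2 * Real.log (K + 1))) *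
        ENNReal.ofReal (Real.exp (-(x ^ 2 / (2 * noiseVar ε p i))))) (by fun_prop)]
  have h1 : ∀ i, ∫⁻ x, ENNReal.ofReal (Real.exp (α + 1 / 2 * Real.log (K + 1))) *
        ENNReal.ofReal (Real.exp (-(x ^ 2 / (2 * noiseVar ε p i))))
          ∂(gaussianReal (θ i) (noiseVar ε p i)) =
      ENNReal.ofReal (Real.exp ((α + 1 / 2 * Real.log (K + 1) - 1 / 2 * Real.log 2) -
        θ i ^ 2 / noiseVar ε p i / 4)) := by
    intro i
    rw [lintegral_const_mul _ (by fun_prop),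
      lintegral_exp_neg_sq_div_gaussianReal _ (noiseVar_pos hε p i).ne',
      ← ENNReal.ofReal_mul (Real.exp_pos _).le, ← Real.exp_add]
    congr 2
    ring
  simp_rw [h1]
  rw [← ENNReal.ofReal_prod_of_nonneg fun i _ => (Real.exp_pos _).le, ← Real.exp_sum]
  refine ENNReal.ofReal_le_ofReal (Real.exp_le_exp.2 ?_)
  rw [Finset.sum_sub_distrib, Finset.sum_const, nsmul_eq_mul, cast_card_Ioc h, ← Finset.sum_div]
  have h2 := hn.le_sum_Ioc hε hp h
  unfold aConst
  rw [Real.log_div (by positivity) two_ne_zero]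
  linarith

/-! ### Small balls under the components -/

theorem measurableSet_l2Norm_sub_le (c : ℕ+ → ℝ) (r : ℝ≥0∞) :
    MeasurableSet {θ : ℕ+ → ℝ | l2Norm (fun i => θ i - c i) ≤ r} := by
  refine measurableSet_le ?_ measurable_const
  unfold l2Norm
  refine Measurable.pow_const (Measurable.tsum fun i => ?_) _
  fun_prop

theorem sum_sq_le_of_l2Norm_le {x : ℕ+ → ℝ} {r : ℝ} (hr : 0 ≤ r)
    (h : l2Norm x ≤ ENNReal.ofReal r) (S : Finset ℕ+) : ∑ i ∈ S, x i ^ 2 ≤ r ^ 2 := by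
  unfold l2Norm at h
  rw [one_div, ENNReal.rpow_inv_le_iff two_pos, ENNReal.rpow_two, ← ENNReal.ofReal_pow hr] at h
  have h1 := (ENNReal.sum_le_tsum S).trans h
  rw [← ENNReal.ofReal_sum_of_nonneg fun i _ => sq_nonneg (x i)] at h1
  exact (ENNReal.ofReal_le_ofReal_iff (sq_nonneg r)).1 h1

/-- Markov's inequality for exp(t(r² - ∑_{i∈S} (θ_i - c_i)²)), whose integral factorises over S. -/
theorem component_ball_le {K ε p : ℝ} (hK : 0 < K) (hε : 0 < ε) (X c : ℕ+ → ℝ) {I : ℕ+}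
    {S : Finset ℕ+} (hS : S.Nonempty) (hSI : ∀ i ∈ S, i ≤ I) {r : ℝ} (hr : 0 < r) :
    component K ε p X I {θ | l2Norm (fun i => θ i - c i) ≤ ENNReal.ofReal r} ≤
      ∏ i ∈ S, ENNReal.ofReal
        (√(Real.exp 1 * r ^ 2 / (S.card * (K / (K + 1)) * noiseVar ε p i))) := by
  have hm : (0 : ℝ) < S.card := by exact_mod_cast hS.card_pos
  -- This t minimises the bound e^{t r²} ∏ (2tLσ_i²)^{-1/2}; it makes t r² = |S|/2, spread as
  -- e^{1/2} over the coordinates.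
  set t : ℝ := S.card / (2 * r ^ 2) with ht
  have ht0 : 0 < t := by positivity
  set ν : ℕ+ → Measure ℝ := fun i =>
    gaussianReal (cutoff X I i) (if i ≤ I then (K / (K + 1)).toNNReal * noiseVar ε p i else 0)
    with hν
  set g : ℕ+ → ℝ → ℝ≥0∞ := fun i x => ENNReal.ofReal (Real.exp (1 / 2)) *
    ENNReal.ofReal (Real.exp (-(t * (x - c i) ^ 2))) with hg
  have hgm : ∀ i, Measurable (g i) := by
    intro i
    simp only [hg]
    fun_prop
  have hsub : {θ : ℕ+ → ℝ | l2Norm (fun i => θ i - c i) ≤ ENNReal.ofReal r} ⊆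
      {θ | 1 ≤ ∏ i ∈ S, g i (θ i)} := by
    intro θ hθ
    have h1 := sum_sq_le_of_l2Norm_le hr.le hθ S
    simp only [hg, Set.mem_ofPred_eq]
    simp_rw [← ENNReal.ofReal_mul (Real.exp_pos _).le, ← Real.exp_add]
    rw [← ENNReal.ofReal_prod_of_nonneg fun i _ => (Real.exp_pos _).le, ← Real.exp_sum,
      ← ENNReal.ofReal_one]
    refine ENNReal.ofReal_le_ofReal (Real.one_le_exp ?_)
    rw [Finset.sum_add_distrib, Finset.sum_const, nsmul_eq_mul, Finset.sum_neg_distrib,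
      ← Finset.mul_sum]
    have h2 : t * ∑ i ∈ S, (θ i - c i) ^ 2 ≤ t * r ^ 2 := by gcongr
    have h3 : t * r ^ 2 = S.card * (1 / 2) := by
      rw [ht]
      field_simp
    linarith
  have hpm : Measurable fun θ : ℕ+ → ℝ => ∏ i ∈ S, g i (θ i) :=
    Finset.measurable_fun_prod _ fun i _ => (hgm i).comp (measurable_pi_apply i)
  have hmarkov := mul_meas_ge_le_lintegral (μ := Measure.infinitePi ν) hpm 1
  rw [one_mul, lintegral_finset_prod_infinitePi ν S g hgm] at hmarkov
  refine (measure_mono hsub).trans (hmarkov.trans (Finset.prod_le_prod' fun i hi => ?_))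
  have hv := noiseVar_pos hε p i
  have hv0 : (0 : ℝ) < noiseVar ε p i := by exact_mod_cast hv
  have hL : 0 < K / (K + 1) := by positivity
  simp only [hg, hν, hSI i hi, if_true]
  rw [lintegral_const_mul _ (by fun_prop)]
  refine (mul_le_mul_right (lintegral_exp_neg_mul_sq_gaussianReal_le _ (c i)
    (mul_pos (Real.toNNReal_pos.2 hL) hv).ne' ht0) _).trans ?_
  rw [← ENNReal.ofReal_mul (Real.exp_pos _).le]
  refine ENNReal.ofReal_le_ofReal (le_of_eq ?_)
  have he : Real.exp (1 / 2) = √(Real.exp 1) := by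
    rw [Real.sqrt_eq_rpow, ← Real.exp_mul, one_mul]
  rw [he, ← Real.sqrt_mul (Real.exp_pos _).le]
  congr 1
  push_cast
  rw [Real.coe_toNNReal _ hL.le, ht]
  field_simp

instance isProbabilityMeasure_component (K ε p : ℝ) (X : ℕ+ → ℝ) (I : ℕ+) :
    IsProbabilityMeasure (component K ε p X I) := by
  unfold component
  infer_instance

instance isProbabilityMeasure_dataLaw (ε p : ℝ) (θ : Param) :
    IsProbabilityMeasure (dataLaw ε p θ) := by
  unfold dataLaw
  infer_instance

/-- Off `s` the index mass is bounded by 1; on `s` it is kept and integrated. Taking `s` empty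
recovers a uniform bound. -/
theorem lintegral_ddm_ball_le {K α ε : ℝ} (hK : 0 < K) (hα : 0 < α) (hε : 0 < ε) (p : ℝ)
    (μ : Measure (ℕ+ → ℝ)) [IsProbabilityMeasure μ] (c : (ℕ+ → ℝ) → ℕ+ → ℝ) (r : ℝ≥0∞)
    (s : Finset ℕ+) {q₀ q₁ : ℝ≥0∞}
    (h₀ : ∀ X, ∀ I ∈ s, component K ε p X I {θ | l2Norm (fun i => θ i - c X i) ≤ r} ≤ q₀)
    (h₁ : ∀ X, ∀ I ∉ s, component K ε p X I {θ | l2Norm (fun i => θ i - c X i) ≤ r} ≤ q₁) :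
    ∫⁻ X, ddm K α ε p X {θ | l2Norm (fun i => θ i - c X i) ≤ r} ∂μ ≤
      q₁ + q₀ * ∑ I ∈ s, ∫⁻ X, indexProb K α ε p X I ∂μ := by
  have hpt : ∀ X, ddm K α ε p X {θ | l2Norm (fun i => θ i - c X i) ≤ r} ≤
      q₁ + q₀ * ∑ I ∈ s, indexProb K α ε p X I := by
    intro X
    unfold ddm
    rw [Measure.sum_apply _ (measurableSet_l2Norm_sub_le _ _)]
    simp only [Measure.smul_apply, smul_eq_mul]
    calc _ ≤ ∑' I, (indexProb K α ε p X I * q₁ +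
          (s : Set ℕ+).indicator (fun I => indexProb K α ε p X I * q₀) I) := by
          refine ENNReal.tsum_le_tsum fun I => ?_
          by_cases hI : I ∈ s
          · rw [Set.indicator_of_mem (by exact_mod_cast hI)]
            exact le_add_left (mul_le_mul_right (h₀ X I hI) _)
          · exact le_add_right (mul_le_mul_right (h₁ X I hI) _)
      _ = (∑' I, indexProb K α ε p X I) * q₁ + q₀ * ∑ I ∈ s, indexProb K α ε p X I := by
          rw [ENNReal.tsum_add, ENNReal.tsum_mul_right, ← tsum_subtype (s : Set ℕ+) fun I =>
              indexProb K α ε p X I * q₀, Finset.tsum_subtype' s fun I => indexProb K α ε p X I * q₀,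
            ← Finset.sum_mul, mul_comm q₀]
      _ ≤ _ := by
          gcongr
          exact mul_le_of_le_one_left' (tsum_indexProb_le_one hα hε K p X)
  refine (lintegral_mono hpt).trans (le_of_eq ?_)
  have hm : ∀ I, Measurable fun X => indexProb K α ε p X I :=
    fun I => measurable_indexProb hK hα hε p I
  rw [lintegral_add_left measurable_const, lintegral_const, measure_univ, mul_one,
    lintegral_const_mul _ (Finset.measurable_fun_sum _ fun I _ => hm I),
    lintegral_finsetSum _ fun I _ => hm I]

/-! ### Bounds at the surrogate oracle scale -/

theorem cumVar_pos {ε : ℝ} (hε : 0 < ε) (p : ℝ) (n : ℕ+) : 0 < cumVar ε p n :=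
  Finset.sum_pos (fun i _ => by exact_mod_cast noiseVar_pos hε p i) ⟨1, by simp⟩

theorem cumVar_le {p : ℝ} (hp : 0 ≤ p) (ε : ℝ) (n : ℕ+) :
    cumVar ε p n ≤ n * (ε ^ 2 * (n : ℝ) ^ (2 * p)) := by
  unfold cumVar
  refine (Finset.sum_le_card_nsmul _ _ (ε ^ 2 * (n : ℝ) ^ (2 * p)) fun i hi => ?_).trans ?_
  · rw [coe_noiseVar]
    unfold kappaSq
    have : (i : ℝ) ≤ n := by exact_mod_cast (Finset.mem_Icc.1 hi).2
    gcongr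
  · simp

theorem component_ball_le_first {K ε p : ℝ} (hK : 0 < K) (hε : 0 < ε) (hp : 0 ≤ p)
    (X c : ℕ+ → ℝ) (I n : ℕ+) {δ : ℝ} (hδ : 0 < δ) :
    component K ε p X I {θ | l2Norm (fun i => θ i - c i) ≤
        ENNReal.ofReal (δ * √(cumVar ε p n))} ≤
      ENNReal.ofReal (√(Real.exp 1 / (K / (K + 1))) * δ * (n : ℝ) ^ (p + 1 / 2)) := by
  have hn : (0 : ℝ) < n := by exact_mod_cast n.pos
  have hV := cumVar_pos hε p n
  refine (component_ball_le hK hε X c (Finset.singleton_nonempty 1) (by simp)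
    (by positivity)).trans ?_
  rw [Finset.prod_singleton]
  refine ENNReal.ofReal_le_ofReal ?_
  rw [Real.sqrt_le_left (by positivity), mul_pow, mul_pow, mul_pow, Real.sq_sqrt hV.le,
    Real.sq_sqrt (by positivity), ← Real.rpow_natCast ((n : ℝ) ^ _), ← Real.rpow_mul hn.le]
  have h1 : (n : ℝ) ^ ((p + 1 / 2) * (2 : ℕ)) = (n : ℝ) ^ (2 * p) * n := by
    rw [← Real.rpow_add_one hn.ne']
    congr 1
    push_cast
    ring
  have h2 : (noiseVar ε p 1 : ℝ) = ε ^ 2 := by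
    rw [coe_noiseVar]
    simp [kappaSq]
  rw [h1, h2, Finset.card_singleton, Nat.cast_one, one_mul, div_le_iff₀ (by positivity)]
  calc Real.exp 1 * (δ ^ 2 * cumVar ε p n)
      ≤ Real.exp 1 * (δ ^ 2 * (n * (ε ^ 2 * (n : ℝ) ^ (2 * p)))) := by
        gcongr
        exact cumVar_le hp ε n
    _ = _ := by field_simp

/-- The block (k, 2k] has k active coordinates, and n ≤ 8k ≤ 8i compares Σ(n) with k σ_i² at the
cost of 8^{2p+1} = 64^{p+1/2}. -/
theorem component_ball_le_pow {K ε p : ℝ} (hK : 0 < K) (hε : 0 < ε) (hp : 0 ≤ p)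
    (X c : ℕ+ → ℝ) {I n k : ℕ+} (hkI : 2 * k ≤ I) (hnk : n ≤ 8 * k) {δ : ℝ} (hδ : 0 < δ) :
    component K ε p X I {θ | l2Norm (fun i => θ i - c i) ≤
        ENNReal.ofReal (δ * √(cumVar ε p n))} ≤
      ENNReal.ofReal (√(Real.exp 1 / (K / (K + 1)) * (64 : ℝ) ^ (p + 1 / 2) * δ ^ 2)) ^
        (k : ℕ) := by
  have hn : (0 : ℝ) < n := by exact_mod_cast n.pos
  have hk : (0 : ℝ) < k := by exact_mod_cast k.pos
  have hnk' : (n : ℝ) ≤ 8 * k := by exact_mod_cast hnk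
  have hV := cumVar_pos hε p n
  have hcard : (Finset.Ioc k (2 * k)).card = k := by
    rw [PNat.card_Ioc, PNat.mul_coe]
    simp only [PNat.val_ofNat]
    omega
  have hne : (Finset.Ioc k (2 * k)).Nonempty := by
    rw [← Finset.card_pos, hcard]
    exact k.pos
  refine (component_ball_le hK hε X c hne (fun i hi => (Finset.mem_Ioc.1 hi).2.trans hkI)
    (by positivity)).trans ?_
  refine (Finset.prod_le_pow_card _ _ (ENNReal.ofReal
    (√(Real.exp 1 / (K / (K + 1)) * (64 : ℝ) ^ (p + 1 / 2) * δ ^ 2))) fun i hi => ?_).trans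
    (by rw [hcard])
  refine ENNReal.ofReal_le_ofReal (Real.sqrt_le_sqrt ?_)
  have hki : (k : ℝ) ≤ i := by exact_mod_cast (Finset.mem_Ioc.1 hi).1.le
  have h1 : (n : ℝ) * (n : ℝ) ^ (2 * p) ≤ 64 ^ (p + 1 / 2) * (k * (i : ℝ) ^ (2 * p)) := by
    have h64 : (64 : ℝ) ^ (p + 1 / 2) = 8 * 8 ^ (2 * p) := by
      rw [show (64 : ℝ) = 8 ^ (2 : ℝ) by norm_num, ← Real.rpow_mul (by norm_num),
        ← Real.rpow_one_add' (by norm_num) (by positivity)]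
      congr 1
      ring
    calc (n : ℝ) * (n : ℝ) ^ (2 * p) ≤ (8 * k) * (8 * i) ^ (2 * p) := by
          gcongr
          exact hnk'.trans (by gcongr)
      _ = _ := by
          rw [Real.mul_rpow (by norm_num) (by positivity), h64]
          ring
  rw [hcard, coe_noiseVar, mul_pow, Real.sq_sqrt hV.le]
  unfold kappaSq
  have hi0 : (0 : ℝ) < i := hk.trans_le hki
  rw [div_le_iff₀ (by positivity)]
  calc Real.exp 1 * (δ ^ 2 * cumVar ε p n)
      ≤ Real.exp 1 * (δ ^ 2 * (n * (ε ^ 2 * (n : ℝ) ^ (2 * p)))) := by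
        gcongr
        exact cumVar_le hp ε n
    _ = Real.exp 1 * δ ^ 2 * ε ^ 2 * (n * (n : ℝ) ^ (2 * p)) := by ring
    _ ≤ Real.exp 1 * δ ^ 2 * ε ^ 2 * (64 ^ (p + 1 / 2) * (k * (i : ℝ) ^ (2 * p))) := by
        gcongr
    _ = _ := by field_simp

theorem sum_lintegral_indexProb_le {K α ε p : ℝ} (hK : 0 < K) (hα : 0 < α)
    (hαK : α < aConst K) (hε : 0 < ε) (hp : 0 ≤ p) {θ : Param} {n m : ℕ+}
    (hn : IsSurrogateOracle ε p θ n) (h : 2 * m ≤ n) :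
    ∑ I ∈ Finset.Icc 1 m, ∫⁻ X, indexProb K α ε p X I ∂(dataLaw ε p θ) ≤
      ENNReal.ofReal (n * Real.exp (-((aConst K - α) * n / 2))) := by
  have hmn : 2 * (m : ℝ) ≤ n := by exact_mod_cast h
  have hm0 : (0 : ℝ) < m := by exact_mod_cast m.pos
  have h1 : ∀ I ∈ Finset.Icc 1 m, ∫⁻ X, indexProb K α ε p X I ∂(dataLaw ε p θ) ≤
      ENNReal.ofReal (Real.exp (-((aConst K - α) * n / 2))) := by
    intro I hI
    have hIm : (I : ℝ) ≤ m := by exact_mod_cast (Finset.mem_Icc.1 hI).2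
    have hIn : I ≤ n := by
      have : (I : ℝ) ≤ n := by linarith
      exact_mod_cast this
    refine (lintegral_indexProb_le hK hα hε hp hn hIn).trans
      (ENNReal.ofReal_le_ofReal (Real.exp_le_exp.2 (neg_le_neg ?_)))
    rw [mul_div_assoc]
    exact mul_le_mul_of_nonneg_left (by linarith) (by linarith)
  refine (Finset.sum_le_card_nsmul _ _ _ h1).trans ?_
  rw [nsmul_eq_mul, ENNReal.ofReal_mul (by positivity)]
  gcongr
  rw [ENNReal.ofReal_natCast, PNat.card_Icc]
  simp only [PNat.one_coe, Nat.add_sub_cancel]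
  have : (m : ℝ) ≤ n := by linarith
  exact_mod_cast this

/-! ### Elementary inequalities -/

/-- The base of the power is at most 1/(4e) ≤ e^{-2}, and the square root at most e^p. The use is
log(1/δ) ≥ 1. -/
theorem deltaSb_le_exp_neg_one {K α p : ℝ} (hK : 0 < K) (hα : 0 < α) (hαK : α < aConst K)
    (hp : 0 ≤ p) : deltaSb K α p ≤ Real.exp (-1) := by
  have ha : 0 < aConst K := hα.trans hαK
  have hc0 : 0 ≤ (aConst K - α) / (4 * Real.exp 1 * aConst K) :=
    div_nonneg (by linarith) (by positivity)
  have hc : (aConst K - α) / (4 * Real.exp 1 * aConst K) ≤ Real.exp (-2) := by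
    rw [div_le_iff₀ (by positivity)]
    have h1 : Real.exp (-2) * (4 * Real.exp 1 * aConst K) = 4 * Real.exp (-1) * aConst K := by
      rw [show (-1 : ℝ) = -2 + 1 by norm_num, Real.exp_add]
      ring
    have h2 : 1 ≤ 4 * Real.exp (-1) := by
      rw [Real.exp_neg, ← div_eq_mul_inv, le_div_iff₀ (Real.exp_pos _)]
      linarith [Real.exp_one_lt_d9]
    rw [h1]
    nlinarith
  have hs : √(K * (2 * p + 1) / (K + 1)) ≤ Real.exp p := by
    rw [Real.sqrt_le_left (Real.exp_pos _).le, ← Real.exp_nat_mul]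
    have h1 : K * (2 * p + 1) / (K + 1) ≤ 2 * p + 1 := by
      rw [div_le_iff₀ (by positivity)]
      nlinarith
    push_cast
    linarith [Real.add_one_le_exp (2 * p)]
  calc deltaSb K α p ≤ _ := min_le_right _ _
    _ ≤ Real.exp p * Real.exp (-2) ^ (p + 1 / 2) := by gcongr
    _ = Real.exp (-1 - p) := by
        rw [← Real.exp_mul, ← Real.exp_add]
        congr 1
        ring
    _ ≤ Real.exp (-1) := Real.exp_le_exp.2 (by linarith)

/-- Here P ≤ l/10 and log 64 ≤ 5, so 64^P costs at most e^{l/2}; the other half of l pays for eM. -/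
theorem mul_exp_one_mul_rpow_le_exp {P l M : ℝ} (hM : 0 < M) (hP : 0 ≤ P)
    (hPl : P * Real.log l ≤ l) (hl : 10 ≤ Real.log l) (hlM : 2 * (1 + Real.log M) ≤ l) :
    Real.exp 1 * M * (64 : ℝ) ^ P ≤ Real.exp l := by
  have h64 : Real.log 64 ≤ 5 := by
    rw [show (64 : ℝ) = 2 ^ 6 by norm_num, Real.log_pow]
    push_cast
    linarith [Real.log_two_lt_d9]
  rw [Real.rpow_def_of_pos (by norm_num)]
  nth_rewrite 1 [← Real.exp_log hM]
  rw [← Real.exp_add, ← Real.exp_add]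
  refine Real.exp_le_exp.2 ?_
  have h1 : Real.log 64 * P ≤ 5 * P := by gcongr
  have h2 : P * 10 ≤ P * Real.log l := by gcongr
  linarith

/-- Half of the decay absorbs (x/l)^P ≤ e^{Px/l}, since P/l ≤ b/4; the other half absorbs the factor
x. The constant is free of P, hence of p. -/
theorem rpow_mul_exp_le {P l b x : ℝ} (hb : 0 < b) (hx : 0 < x) (hP : 0 ≤ P) (hl : 0 < l)
    (hPl : P * Real.log l ≤ l) (hlb : 4 / b ≤ Real.log l) :
    x ^ P * (x * Real.exp (-(b * x / 2))) ≤ 4 / b * l ^ P := by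
  have h1 : x ^ P ≤ l ^ P * Real.exp (b * x / 4) := by
    have h2 : x = l * (x / l) := by field_simp
    have h3 : x / l ≤ Real.exp (x / l) := by linarith [Real.add_one_le_exp (x / l)]
    have h4 : P ≤ l * (b / 4) := by
      have h5 : P * (4 / b) ≤ l := (mul_le_mul_of_nonneg_left hlb hP).trans hPl
      rw [mul_div_assoc', div_le_iff₀ hb] at h5
      linarith
    calc x ^ P = l ^ P * (x / l) ^ P := by
          nth_rewrite 1 [h2]
          rw [Real.mul_rpow hl.le (by positivity)]
      _ ≤ l ^ P * Real.exp (x / l) ^ P := by gcongr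
      _ = l ^ P * Real.exp (x / l * P) := by rw [Real.exp_mul]
      _ ≤ l ^ P * Real.exp (b * x / 4) := by
          gcongr
          calc x / l * P ≤ x / l * (l * (b / 4)) := by gcongr
            _ = b * x / 4 := by field_simp
  have h6 : x ≤ 4 / b * Real.exp (b * x / 4) := by
    have h7 := Real.add_one_le_exp (b * x / 4)
    rw [div_mul_eq_mul_div, le_div_iff₀ hb]
    linarith
  calc x ^ P * (x * Real.exp (-(b * x / 2)))
      ≤ (l ^ P * Real.exp (b * x / 4)) *
        ((4 / b * Real.exp (b * x / 4)) * Real.exp (-(b * x / 2))) := by gcongr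
    _ = 4 / b * l ^ P *
        (Real.exp (b * x / 4) * Real.exp (b * x / 4) * Real.exp (-(b * x / 2))) := by ring
    _ = 4 / b * l ^ P := by
        rw [← Real.exp_add, ← Real.exp_add]
        ring_nf
        simp

theorem lintegral_ddm_ball_le_of_lt {K α ε p : ℝ} (hK : 0 < K) (hα : 0 < α)
    (hαK : α < aConst K) (hε : 0 < ε) (hp : 0 ≤ p) {θ : Param} {n : ℕ+}
    (hn : IsSurrogateOracle ε p θ n) (c : (ℕ+ → ℝ) → ℕ+ → ℝ) {δ l : ℝ}
    (hδl : δ = Real.exp (-l)) (hln : l < n) (hPl : (p + 1 / 2) * Real.log l ≤ l)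
    (hl : 10 ≤ Real.log l) (hlb : 4 / (aConst K - α) ≤ Real.log l)
    (hlK : 2 * (1 + Real.log (K / (K + 1))⁻¹) ≤ l) (hl1 : 1 ≤ l) :
    ∫⁻ X, ddm K α ε p X {θ | l2Norm (fun i => θ i - c X i) ≤
        ENNReal.ofReal (δ * √(cumVar ε p n))} ∂(dataLaw ε p θ) ≤
      ENNReal.ofReal (δ + √(Real.exp 1 / (K / (K + 1))) * (4 / (aConst K - α)) *
        (δ * l ^ (p + 1 / 2))) := by
  have hδ : 0 < δ := hδl ▸ Real.exp_pos _
  have hn0 : (0 : ℝ) < n := by exact_mod_cast n.pos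
  have hL : 0 < K / (K + 1) := by positivity
  have hl10 : 10 ≤ l := by linarith [Real.log_le_sub_one_of_pos (show 0 < l by linarith)]
  have hn10 : 10 < (n : ℕ) := by
    have : (10 : ℝ) < n := by linarith
    exact_mod_cast this
  -- With n > 10 this gives 4k ≤ n ≤ 8k and k ≥ 2; the last turns √δ^k into at most δ.
  set k : ℕ+ := ⟨(n : ℕ) / 4, by omega⟩ with hk
  have hkc : (k : ℕ) = (n : ℕ) / 4 := rfl
  have hn8 : n ≤ 8 * k := by
    rw [← PNat.coe_le_coe, PNat.mul_coe, hkc, PNat.val_ofNat]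
    omega
  have hkn : 2 * (2 * k) ≤ n := by
    rw [← PNat.coe_le_coe, PNat.mul_coe, PNat.mul_coe, hkc, PNat.val_ofNat]
    omega
  refine (lintegral_ddm_ball_le hK hα hε p (dataLaw ε p θ) c _ (Finset.Icc 1 (2 * k))
    (fun X I _ => component_ball_le_first hK hε hp X (c X) I n hδ) (q₁ := ENNReal.ofReal δ)
    fun X I hI => ?_).trans ?_
  · have hkI : 2 * k ≤ I := by
      simp only [Finset.mem_Icc, one_le, true_and, not_le] at hI
      exact hI.le
    refine (component_ball_le_pow hK hε hp X (c X) hkI hn8 hδ).trans ?_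
    have h1 := mul_exp_one_mul_rpow_le_exp (inv_pos.2 hL) (by positivity) hPl hl hlK
    have h2 : Real.exp 1 / (K / (K + 1)) * (64 : ℝ) ^ (p + 1 / 2) * δ ^ 2 ≤ δ := by
      calc _ ≤ Real.exp l * δ ^ 2 := by gcongr; exact h1
        _ = δ := by
          rw [hδl, ← Real.exp_nat_mul, ← Real.exp_add]
          congr 1
          push_cast
          ring
    have hδ1 : δ ≤ 1 := by
      rw [hδl]
      exact Real.exp_le_one_iff.2 (by linarith)
    rw [← ENNReal.ofReal_pow (Real.sqrt_nonneg _)]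
    refine ENNReal.ofReal_le_ofReal ?_
    calc _ ≤ √δ ^ (k : ℕ) := by gcongr
      _ ≤ √δ ^ 2 := pow_le_pow_of_le_one (Real.sqrt_nonneg _) (Real.sqrt_le_one.2 hδ1) (by omega)
      _ = δ := Real.sq_sqrt hδ.le
  · rw [ENNReal.ofReal_add hδ.le (mul_nonneg (mul_nonneg (Real.sqrt_nonneg _)
      (div_nonneg (by norm_num) (by linarith))) (by positivity))]
    gcongr
    refine (mul_le_mul_right (sum_lintegral_indexProb_le hK hα hαK hε hp hn hkn) _).trans ?_
    rw [← ENNReal.ofReal_mul (by positivity)]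
    refine ENNReal.ofReal_le_ofReal ?_
    have h3 := rpow_mul_exp_le (sub_pos.2 hαK) hn0 (P := p + 1 / 2) (by positivity)
      (by linarith) hPl hlb
    calc _ = √(Real.exp 1 / (K / (K + 1))) * δ * ((n : ℝ) ^ (p + 1 / 2) *
          (n * Real.exp (-((aConst K - α) * n / 2)))) := by ring
      _ ≤ √(Real.exp 1 / (K / (K + 1))) * δ * (4 / (aConst K - α) * l ^ (p + 1 / 2)) := by
          gcongr
      _ = _ := by ring

end DDM

theorem theorem3p3 (K α : ℝ) (hK : 0 < K) (hα : 0 < α) (hαK : α < DDM.aConst K) :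
    ∃ C : ℝ, 0 < C ∧
      ∀ p : ℝ, 0 ≤ p → ∀ ε : ℝ, 0 < ε →
      ∀ θ₀ : DDM.Param, ∀ Ibar : ℕ+, DDM.IsSurrogateOracle ε p θ₀ Ibar →
      ∀ θhat : (ℕ+ → ℝ) → DDM.Param, (∀ i : ℕ+, Measurable fun X => θhat X i) →
      ∀ δ : ℝ, 0 < δ → δ ≤ DDM.deltaSb K α p →
        ∫⁻ X, DDM.ddm K α ε p X
            {θ | DDM.l2Norm (fun i => θ i - θhat X i) ≤
              ENNReal.ofReal (δ * √(DDM.cumVar ε p Ibar))} ∂(DDM.dataLaw ε p θ₀) ≤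
          ENNReal.ofReal (C * δ * Real.log δ⁻¹ ^ (p + 1 / 2)) := by
  have hb : 0 < DDM.aConst K - α := sub_pos.2 hαK
  set b := DDM.aConst K - α with hbdef
  set A := √(Real.exp 1 / (K / (K + 1))) with hA
  have hA0 : 0 ≤ A := Real.sqrt_nonneg _
  -- For l > l₀ these thresholds give log l ≥ T and absorb 64^P, the constant e/L and the decay rate
  -- b, uniformly in p.
  set T := max 10 (4 / b) with hT
  set l₀ := max (Real.exp T) (2 * (1 + Real.log (K / (K + 1))⁻¹)) with hl₀
  -- The term e^{l₀} covers l ≤ l₀, A covers n ≤ l, 4A/b covers small indices when n > l, and 1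
  -- covers large indices and the case δ l^P ≥ 1.
  refine ⟨Real.exp l₀ + A * (1 + 4 / b) + 1, by positivity, ?_⟩
  intro p hp ε hε θ₀ n hn θhat _ δ hδ hδsb
  set l := Real.log δ⁻¹ with hl
  have hδl : δ = Real.exp (-l) := by
    rw [hl, Real.log_inv, neg_neg, Real.exp_log hδ]
  have hl1 : 1 ≤ l := by
    have h := hδsb.trans (DDM.deltaSb_le_exp_neg_one hK hα hαK hp)
    rw [hδl, Real.exp_le_exp] at h
    linarith
  have hlP : 1 ≤ l ^ (p + 1 / 2) := Real.one_le_rpow hl1 (by positivity)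
  set Q := l ^ (p + 1 / 2) with hQ
  have hfrac : 0 ≤ A * (1 + 4 / b) := by positivity
  have htriv : 1 ≤ (Real.exp l₀ + A * (1 + 4 / b) + 1) * δ * Q →
      ∫⁻ X, DDM.ddm K α ε p X {θ | DDM.l2Norm (fun i => θ i - θhat X i) ≤
        ENNReal.ofReal (δ * √(DDM.cumVar ε p n))} ∂(DDM.dataLaw ε p θ₀) ≤
      ENNReal.ofReal ((Real.exp l₀ + A * (1 + 4 / b) + 1) * δ * Q) := by
    intro h
    refine (DDM.lintegral_ddm_ball_le hK hα hε p (DDM.dataLaw ε p θ₀) (fun X i => θhat X i) _ ∅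
      (q₀ := 0) (q₁ := 1) (by simp) fun X I _ => prob_le_one).trans ?_
    simpa using h
  have hδQ : 0 < δ * Q := by positivity
  rcases le_or_gt l l₀ with h1 | h1
  · refine htriv ?_
    have h2 : 1 ≤ Real.exp l₀ * δ := by
      rw [hδl, ← Real.exp_add]
      exact Real.one_le_exp (by linarith)
    have h3 : 1 ≤ Real.exp l₀ * δ * Q := by nlinarith
    nlinarith
  rcases le_or_gt 1 (δ * Q) with h2 | h2
  · refine htriv ?_
    nlinarith [Real.exp_pos l₀]
  have hl0 : 0 < l := by linarith
  -- Now δ l^P = exp(P log l - l) < 1, which limits p in terms of δ and so keeps constants free of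
  -- p.
  have hPl : (p + 1 / 2) * Real.log l ≤ l := by
    rw [hδl, hQ, Real.rpow_def_of_pos hl0, ← Real.exp_add, Real.exp_lt_one_iff] at h2
    linarith
  have hTl : T ≤ Real.log l := by
    rw [Real.le_log_iff_exp_le hl0]
    exact (le_max_left _ _).trans h1.le
  rcases le_or_gt (n : ℝ) l with h3 | h3
  · refine (DDM.lintegral_ddm_ball_le hK hα hε p (DDM.dataLaw ε p θ₀) (fun X i => θhat X i) _ ∅
      (q₀ := 0) (by simp) fun X I _ =>
        DDM.component_ball_le_first hK hε hp X (fun i => θhat X i) I n hδ).trans ?_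
    simp only [Finset.sum_empty, mul_zero, add_zero]
    refine ENNReal.ofReal_le_ofReal ?_
    have h4 : (n : ℝ) ^ (p + 1 / 2) ≤ Q := by
      rw [hQ]
      gcongr
    calc A * δ * (n : ℝ) ^ (p + 1 / 2) ≤ A * δ * Q := by gcongr
      _ ≤ _ := by
        have h5 : 0 ≤ A * (4 / b) := by positivity
        have : A ≤ Real.exp l₀ + A * (1 + 4 / b) + 1 := by nlinarith [Real.exp_pos l₀]
        gcongr
  · refine (DDM.lintegral_ddm_ball_le_of_lt hK hα hαK hε hp hn (fun X i => θhat X i) hδl h3 hPl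
      ((le_max_left _ _).trans hTl) ((le_max_right _ _).trans hTl)
      ((le_max_right _ _).trans h1.le) hl1).trans (ENNReal.ofReal_le_ofReal ?_)
    have h5 : δ ≤ δ * Q := le_mul_of_one_le_right hδ.le hlP
    have h6 : 0 ≤ Real.exp l₀ * (δ * Q) := by positivity
    have h7 : 0 ≤ A * (δ * Q) := by positivity
    calc δ + A * (4 / b) * (δ * Q) ≤ δ * Q + A * (4 / b) * (δ * Q) := by gcongr
      _ ≤ Real.exp l₀ * (δ * Q) + A * (δ * Q) + A * (4 / b) * (δ * Q) + δ * Q := by linarith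
      _ = _ := by ring
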